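/- Let $0\le k\le n$ and $m\ge 1$ be integers. Let $G_{n,k}$ be the Grassmannian of $k$-dimensional linear subspaces of $\mathbb R^n$, equipped with its rotation-invariant (Haar) probability measure $dE$. For a real number $p\neq 0$ and a function $f$ on a measure space $(X,\mu)$ put $\|f\|_p=\left(\int_X |f|^p\,d\mu\right)^{1/p}\in[0,\infty]$, and write $f\in L^p$ if $f$ is measurable and $\int_X|f|^p\,d\mu<\infty$. Let $p_1,\dots,p_m$ and $\alpha_1,\dots,\alpha_m$ be real numbers, $p_i\ne 0$, with $\sum_{i=1}^m \alpha_i/p_i=n$, and let $f_1,\dots,f_m:\mathbb R^n\to\mathbb R$ be bounded functions with $f_i\in L^{p_i}(\mathbb R^n)$. Define $$I(f_1,\dots,f_m)=\int_{G_{n,k}}\prod_{i=1}^m \big\|f_i|_E\big\|_{p_i}^{\alpha_i}\,dE\in[0,\infty],$$ where $f_i|_E$ is the restriction of $f_i$ to $E$, the norm $\|f_i|_E\|_{p_i}$ is taken with respect to $k$-dimensional Lebesgue measure on $E$, and $0\cdot\infty=0$ in the product. If $I(f_1,\dots,f_m)<\infty$, then for every volume-preserving linear transformation $g$ of $\mathbb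 R^n$ (that is, $|\det g|=1$; in particular for every $g\in SL(n)$), $$I(f_1\circ g^{-1},\dots,f_m\circ g^{-1})=I(f_1,\dots,f_m).$$ -/

import Mathlib

open MeasureTheory Module
open scoped ENNReal

noncomputable section

/-- The Grassmannian `G_{n,k}` of `k`-dimensional linear subspaces of Euclidean space `ℝⁿ`. -/
def Gr (n k : ℕ) : Type :=
  {E : Submodule ℝ (EuclideanSpace ℝ (Fin n)) // finrank ℝ E = k}

namespace Gr

/-- The usual topology of the Grassmannian: a subspace is identified with the orthogonal
projection onto it. -/
instance instTopologicalSpace (n k : ℕ) : TopologicalSpace (Gr n k) :=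
  TopologicalSpace.induced (fun E => E.1.starProjection) inferInstance

/-- The Grassmannian carries its Borel σ-algebra. -/
instance instMeasurableSpace (n k : ℕ) : MeasurableSpace (Gr n k) := borel _

instance instBorelSpace (n k : ℕ) : BorelSpace (Gr n k) := ⟨rfl⟩

end Gr

/-- The orthogonal group `O(n)`, as the group of linear operators `U` on `ℝⁿ` such that
`U* U = U U* = 1`. -/
abbrev OrthGroup (n : ℕ) : Type :=
  unitary (EuclideanSpace ℝ (Fin n) →L[ℝ] EuclideanSpace ℝ (Fin n))

instance OrthGroup.instContinuousStar (n : ℕ) :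
    ContinuousStar (EuclideanSpace ℝ (Fin n) →L[ℝ] EuclideanSpace ℝ (Fin n)) :=
  ⟨ContinuousLinearMap.adjoint.continuous⟩

instance OrthGroup.instCompactSpace (n : ℕ) : CompactSpace (OrthGroup n) := by
  apply isCompact_iff_compactSpace.mp
  refine Metric.isCompact_of_isClosed_isBounded isClosed_unitary ?_
  refine (Metric.isBounded_closedBall
    (x := (0 : EuclideanSpace ℝ (Fin n) →L[ℝ] EuclideanSpace ℝ (Fin n))) (r := 1)).subset ?_
  intro U hU
  rw [mem_closedBall_zero_iff]
  refine ContinuousLinearMap.opNorm_le_bound _ zero_le_one fun x => ?_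
  rw [one_mul]
  exact ((Unitary.linearIsometryEquiv ⟨U, hU⟩).norm_map x).le

/-- The Haar probability measure of `O(n)`. -/
def OrthGroup.haarProb (n : ℕ) : Measure (OrthGroup n) := Measure.haarMeasure ⊤

instance OrthGroup.instIsProbabilityMeasure (n : ℕ) :
    IsProbabilityMeasure (OrthGroup.haarProb n) :=
  ⟨by simpa [OrthGroup.haarProb] using
    Measure.haarMeasure_self (K₀ := (⊤ : TopologicalSpace.PositiveCompacts (OrthGroup n)))⟩

namespace Gr

/-- The action of `O(n)` on the Grassmannian, `(U, E) ↦ U E`. -/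
def rotate {n k : ℕ} (U : OrthGroup n) (E : Gr n k) : Gr n k :=
  ⟨E.1.map ((Unitary.linearIsometryEquiv U).toLinearEquiv :
      EuclideanSpace ℝ (Fin n) →ₗ[ℝ] EuclideanSpace ℝ (Fin n)),
    ((Unitary.linearIsometryEquiv U).toLinearEquiv.finrank_map_eq E.1).trans E.2⟩

lemma continuous_rotate {n k : ℕ} (E : Gr n k) :
    Continuous fun U : OrthGroup n => rotate U E := by
  refine continuous_induced_rng.2 ?_
  have h : ((fun F : Gr n k => F.1.starProjection) ∘ fun U : OrthGroup n => rotate U E) =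
      fun U : OrthGroup n =>
        (U : EuclideanSpace ℝ (Fin n) →L[ℝ] EuclideanSpace ℝ (Fin n)) * E.1.starProjection *
          ((U⁻¹ : OrthGroup n) : EuclideanSpace ℝ (Fin n) →L[ℝ] EuclideanSpace ℝ (Fin n)) := by
    funext U
    ext1 x
    exact Submodule.starProjection_map_apply (Unitary.linearIsometryEquiv U) E.1 x
  rw [h]
  exact (continuous_subtype_val.mul continuous_const).mul
    (continuous_subtype_val.comp continuous_inv)

/-- The coordinate subspace `ℝ e₁ ⊕ ⋯ ⊕ ℝ e_k`. -/
def coordSubspace {n k : ℕ} (hk : k ≤ n) : Gr n k :=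
  ⟨Submodule.span ℝ (Set.range fun j : Fin k => EuclideanSpace.single (Fin.castLE hk j) (1 : ℝ)), by
    have h : LinearIndependent ℝ
        fun j : Fin k => EuclideanSpace.single (Fin.castLE hk j) (1 : ℝ) := by
      have h0 := (EuclideanSpace.basisFun (Fin n) ℝ).toBasis.linearIndependent.comp
        (Fin.castLE hk) (Fin.castLE_injective hk)
      have h1 : (fun j : Fin k => EuclideanSpace.single (Fin.castLE hk j) (1 : ℝ)) =
          (EuclideanSpace.basisFun (Fin n) ℝ).toBasis ∘ Fin.castLE hk := by
        funext j
        simp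
      rw [h1]
      exact h0
    simpa using finrank_span_eq_card h⟩

/-- The Haar (rotation-invariant) probability measure `μ_{n,k}` of the Grassmannian: the law of
`U E₀`, where `E₀ = ℝ e₁ ⊕ ⋯ ⊕ ℝ e_k` and `U` is distributed according to the Haar probability
measure of `O(n)`. -/
def haar {n k : ℕ} (hk : k ≤ n) : Measure (Gr n k) :=
  (OrthGroup.haarProb n).map fun U => rotate U (coordSubspace hk)

instance instIsProbabilityMeasure {n k : ℕ} (hk : k ≤ n) : IsProbabilityMeasure (haar hk) :=
  Measure.isProbabilityMeasure_map (continuous_rotate _).measurable.aemeasurable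

end Gr

/-- `‖f‖_p = (∫ |f|^p dμ)^(1/p) ∈ [0, ∞]` for a real exponent `p ≠ 0`, with the usual
conventions `0^p = ∞`, `∞^p = 0` for `p < 0`. -/
def realLpNorm {X : Type*} [MeasurableSpace X] (f : X → ℝ) (p : ℝ) (μ : Measure X) : ℝ≥0∞ :=
  (∫⁻ x, ‖f x‖ₑ ^ p ∂μ) ^ (1 / p)

/-- `f ∈ L^p(μ)` for a real exponent `p ≠ 0`: `f` is measurable and `∫ |f|^p dμ < ∞`. -/
def MemRealLp {X : Type*} [MeasurableSpace X] (f : X → ℝ) (p : ℝ) (μ : Measure X) : Prop :=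
  AEStronglyMeasurable f μ ∧ ∫⁻ x, ‖f x‖ₑ ^ p ∂μ < ∞

/-- For positive exponents these are the norm and the `L^p` functions of Mathlib. -/
lemma realLpNorm_eq_eLpNorm {X : Type*} [MeasurableSpace X] (f : X → ℝ) {p : ℝ} (hp : 0 < p)
    (μ : Measure X) : realLpNorm f p μ = eLpNorm f (ENNReal.ofReal p) μ := by
  rw [eLpNorm_eq_lintegral_rpow_enorm_toReal (by simpa using hp) ENNReal.ofReal_ne_top,
    ENNReal.toReal_ofReal hp.le, realLpNorm]

lemma memRealLp_iff_memLp {X : Type*} [MeasurableSpace X] (f : X → ℝ) {p : ℝ} (hp : 0 < p)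
    (μ : Measure X) : MemRealLp f p μ ↔ MemLp f (ENNReal.ofReal p) μ := by
  have h0 : ENNReal.ofReal p ≠ 0 := by simpa using hp
  rw [MemRealLp, MemLp, eLpNorm_lt_top_iff_lintegral_rpow_enorm_lt_top h0 ENNReal.ofReal_ne_top,
    ENNReal.toReal_ofReal hp.le]

/-- `I(f₁, …, f_m) = ∫_{G_{n,k}} ∏ᵢ ‖fᵢ|_E‖_{pᵢ}^{αᵢ} dE ∈ [0, ∞]`, where `‖·‖_{pᵢ}` is taken with
respect to `k`-dimensional Lebesgue measure of the subspace `E`. -/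
def grassmannIntegral {n k m : ℕ} (hk : k ≤ n) (p α : Fin m → ℝ)
    (f : Fin m → EuclideanSpace ℝ (Fin n) → ℝ) : ℝ≥0∞ :=
  ∫⁻ E : Gr n k, ∏ i, realLpNorm (fun t : E.1 => f i t) (p i) volume ^ α i ∂(Gr.haar hk)

end

/-! Let h = g⁻¹ and let σ(E) be the factor by which h scales k-volume on E. Passing from E to hE
multiplies the i-th factor of the integrand, taken with fᵢ ∘ h on E, by σ(E)^(αᵢ/pᵢ)
(`Gr.realLpNorm_map`), hence the product by σ(E)^n. The Haar measure compensates: if |det h| = 1,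
then ∫ σ(E)^(-n) φ(hE) dE = ∫ φ(E) dE (`Gr.lintegral_map_mul_volumeFactor`).

This Jacobian is found without charts, on Hom(ℝᵏ, ℝⁿ) with Lebesgue measure. Almost every X is
injective, and the range of a uniform X in the unit ball is Haar distributed, by rotation invariance
(`Gr.setLIntegral_ofMap`). Put Φ(X) = normDet(X)^(-n) φ(range X). Then Φ(XA) = |det A|^(-n) Φ(X), so
Φ dX is invariant under the right action of GL_k, and ∫ HΦ depends on H only through its averages
over GL_k-orbits (`lintegral_mul_eq_of_average_eq`). For H = normDet^n cut off to the unit ball,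
these averages are one constant, unchanged when H is replaced by H(h⁻¹ ·). Hence ∫ H(h⁻¹X)Φ(X) dX =
∫ H(X)Φ(X) dX (`lintegral_ballWeight_comp_mul`). The right side is the ball integral of φ(range X);
after X ↦ hX, the left side is that of σ^(-n) φ(h ·). -/

set_option linter.unusedSectionVars false

/-! ### Determinants and linear changes of variables. -/

section LinearAlgebra

theorem lintegral_comp_linearEquiv {E : Type*} [NormedAddCommGroup E] [NormedSpace ℝ E]
    [FiniteDimensional ℝ E] [MeasurableSpace E] [BorelSpace E] (ν : Measure E) [ν.IsAddHaarMeasure]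
    (e : E ≃ₗ[ℝ] E) (f : E → ℝ≥0∞) :
    ∫⁻ x, f (e x) ∂ν = ENNReal.ofReal |LinearMap.det (e : E →ₗ[ℝ] E)|⁻¹ * ∫⁻ x, f x ∂ν := by
  have h := lintegral_map_equiv (μ := ν) f
    e.toContinuousLinearEquiv.toHomeomorph.toMeasurableEquiv
  have h2 := Measure.map_linearMap_addHaar_eq_smul_addHaar ν e.isUnit_det'.ne_zero
  have h3 : ν.map e.toContinuousLinearEquiv.toHomeomorph.toMeasurableEquiv =
      ENNReal.ofReal |(LinearMap.det (e : E →ₗ[ℝ] E))⁻¹| • ν := h2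
  rw [h3, lintegral_smul_measure, abs_inv] at h
  exact h.symm

variable {F V : Type*} [NormedAddCommGroup F] [InnerProductSpace ℝ F] [FiniteDimensional ℝ F]
  [NormedAddCommGroup V] [InnerProductSpace ℝ V] [FiniteDimensional ℝ V]

/-- A linear isomorphism of Euclidean spaces multiplies volumes by its norm determinant; no
measurability of the integrand is needed. -/
theorem lintegral_eq_normDet_mul_lintegral_comp [MeasurableSpace F] [BorelSpace F]
    [MeasurableSpace V] [BorelSpace V] (e : F ≃ₗ[ℝ] V) (f : V → ℝ≥0∞) :
    ∫⁻ y, f y = ENNReal.ofReal (e : F →ₗ[ℝ] V).normDet * ∫⁻ x, f (e x) := by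
  let Q : F ≃ₗᵢ[ℝ] V := (stdOrthonormalBasis ℝ F).equiv (stdOrthonormalBasis ℝ V)
    (finCongr e.finrank_eq)
  let R : F ≃ₗ[ℝ] F := e.trans Q.symm.toLinearEquiv
  have hR : (e : F →ₗ[ℝ] V).normDet = |LinearMap.det (R : F →ₗ[ℝ] F)| := by
    rw [← LinearMap.normDet_eq_abs_det]
    have h1 : (e : F →ₗ[ℝ] V) = Q.toLinearIsometry.toLinearMap ∘ₗ (R : F →ₗ[ℝ] F) := by
      ext x; simp [R]
    rw [h1, LinearMap.normDet_comp_of_finrank_eq _ _ rfl, LinearIsometry.normDet_eq_one, one_mul]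
  have hdet : 0 < |LinearMap.det (R : F →ₗ[ℝ] F)| := abs_pos.2 R.isUnit_det'.ne_zero
  have h2 : ∫⁻ y, f y = ∫⁻ x, f (Q x) :=
    MeasurePreserving.lintegral_map_equiv f Q.toHomeomorph.toMeasurableEquiv
      (LinearIsometryEquiv.measurePreserving Q)
  have h3 := lintegral_comp_linearEquiv volume R fun x => f (Q x)
  have h4 : ∀ x, Q (R x) = e x := fun x => by simp [R]
  simp only [h4] at h3
  rw [h2, h3, hR, ← mul_assoc, ← ENNReal.ofReal_mul hdet.le, mul_inv_cancel₀ hdet.ne',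
    ENNReal.ofReal_one, one_mul]

theorem LinearMap.det_one_add_comp_comm (A : F →ₗ[ℝ] V) (B : V →ₗ[ℝ] F) :
    LinearMap.det (1 + A ∘ₗ B) = LinearMap.det (1 + B ∘ₗ A) := by
  let b := (stdOrthonormalBasis ℝ F).toBasis
  let c := (stdOrthonormalBasis ℝ V).toBasis
  rw [← LinearMap.det_toMatrix c, ← LinearMap.det_toMatrix b, map_add, map_add,
    LinearMap.toMatrix_comp c b c, LinearMap.toMatrix_comp b c b, LinearMap.toMatrix_one,
    LinearMap.toMatrix_one, Matrix.det_one_add_mul_comm]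

/-- A basis of F turns the space of maps into copies of V, one per basis vector, on each of which g
acts. -/
theorem det_compL (g : V →L[ℝ] V) :
    LinearMap.det (ContinuousLinearMap.compL ℝ F V V g : (F →L[ℝ] V) →ₗ[ℝ] (F →L[ℝ] V)) =
      LinearMap.det (g : V →ₗ[ℝ] V) ^ finrank ℝ F := by
  let b := (stdOrthonormalBasis ℝ F).toBasis
  let e : (F →L[ℝ] V) ≃ₗ[ℝ] (Fin (finrank ℝ F) → V) :=
    LinearMap.toContinuousLinearMap.symm.trans (b.constr ℝ).symm
  rw [← LinearMap.det_conj _ e]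
  have h : e.toLinearMap ∘ₗ
      (ContinuousLinearMap.compL ℝ F V V g : (F →L[ℝ] V) →ₗ[ℝ] (F →L[ℝ] V)) ∘ₗ
      e.symm.toLinearMap =
      LinearMap.pi fun i => (g : V →ₗ[ℝ] V) ∘ₗ LinearMap.proj i := by
    refine LinearMap.ext fun x => funext fun i => ?_
    simp [e, Basis.constr_symm_apply]
  rw [h, LinearMap.det_pi]
  simp

/-- Coordinates in V turn the space of maps into copies of the dual of F, on each of which the
transpose of A acts. -/
theorem det_flip_compL (A : F →L[ℝ] F) :
    LinearMap.det ((ContinuousLinearMap.compL ℝ F F V).flip A : (F →L[ℝ] V) →ₗ[ℝ] (F →L[ℝ] V)) =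
      LinearMap.det (A : F →ₗ[ℝ] F) ^ finrank ℝ V := by
  let c := (stdOrthonormalBasis ℝ V).toBasis
  let e : (F →L[ℝ] V) ≃ₗ[ℝ] (Fin (finrank ℝ V) → Dual ℝ F) :=
    LinearEquiv.ofBijective
      (LinearMap.pi fun i => (LinearMap.llcomp ℝ F V ℝ (c.coord i)) ∘ₗ
        (LinearMap.toContinuousLinearMap (𝕜 := ℝ) (E := F) (F' := V)).symm.toLinearMap) <| by
      constructor
      · intro X Y h
        ext1 x
        refine c.ext_elem fun i => ?_
        exact LinearMap.congr_fun (congr_fun h i) x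
      · intro l
        refine ⟨LinearMap.toContinuousLinearMap (∑ i, (l i).smulRight (c i)), ?_⟩
        funext i
        ext x
        simp [Finsupp.single_apply]
  have h : LinearMap.pi (fun i => (A : F →ₗ[ℝ] F).dualMap ∘ₗ LinearMap.proj i) =
      e.toLinearMap ∘ₗ
      ((ContinuousLinearMap.compL ℝ F F V).flip A : (F →L[ℝ] V) →ₗ[ℝ] (F →L[ℝ] V)) ∘ₗ
      e.symm.toLinearMap := by
    refine LinearMap.ext fun l => ?_
    obtain ⟨X, rfl⟩ := e.surjective l
    simp only [LinearMap.comp_apply, LinearEquiv.coe_coe, LinearEquiv.symm_apply_apply]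
    rfl
  rw [← LinearMap.det_conj _ e, ← h, LinearMap.det_pi]
  simp [LinearMap.det_dualMap]

end LinearAlgebra

/-! ### Orthogonal projections onto ranges and images of subspaces. -/

section Projections

variable {F V : Type*} [NormedAddCommGroup F] [InnerProductSpace ℝ F] [FiniteDimensional ℝ F]
  [CompleteSpace F]
  [NormedAddCommGroup V] [InnerProductSpace ℝ V] [FiniteDimensional ℝ V] [CompleteSpace V]

theorem ContinuousLinearMap.isUnit_of_injective {f : V →L[ℝ] V} (hf : Function.Injective f) :
    IsUnit f := by
  rw [ContinuousLinearMap.isUnit_iff_bijective]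
  exact ⟨hf, LinearMap.injective_iff_surjective.1 hf⟩

theorem ContinuousLinearMap.adjoint_comp_self_isUnit {X : F →L[ℝ] V} (hX : Function.Injective X) :
    IsUnit (X.adjoint ∘L X) := by
  apply ContinuousLinearMap.isUnit_of_injective
  rw [injective_iff_map_eq_zero]
  intro x hx
  apply (injective_iff_map_eq_zero X).1 hX
  rw [← inner_self_eq_zero (𝕜 := ℝ), ← ContinuousLinearMap.adjoint_inner_right]
  simp only [ContinuousLinearMap.comp_apply] at hx
  rw [hx, inner_zero_right]

/-- The normal equations. The formula shows that the projection depends continuously on an injective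
X. -/
theorem Submodule.starProjection_range {X : F →L[ℝ] V} (hX : Function.Injective X) :
    X.range.starProjection = X ∘L Ring.inverse (X.adjoint ∘L X) ∘L X.adjoint := by
  ext1 v
  refine (Submodule.eq_starProjection_of_mem_orthogonal ⟨_, rfl⟩ ?_)
  rw [Submodule.mem_orthogonal]
  rintro _ ⟨y, rfl⟩
  have h := Ring.mul_inverse_cancel _ (ContinuousLinearMap.adjoint_comp_self_isUnit hX)
  have h' := DFunLike.congr_fun h (X.adjoint v)
  simp only [mul_apply_eq_comp, ContinuousLinearMap.comp_apply,
    one_apply_eq_self] at h'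
  have : inner ℝ (X y) (v - X (Ring.inverse (X.adjoint ∘L X) (X.adjoint v))) = 0 := by
    rw [← ContinuousLinearMap.adjoint_inner_right, map_sub, h', sub_self, inner_zero_right]
  exact this

/-- The operator `1 + P_E (h* h - 1)`; it preserves `E`, and on `E` it is the compression
of `h* h`. -/
noncomputable def compressionGram (h : V →L[ℝ] V) (E : Submodule ℝ V) : V →L[ℝ] V :=
  1 + E.starProjection * (h.adjoint * h - 1)

theorem compressionGram_apply_of_mem (h : V →L[ℝ] V) {E : Submodule ℝ V} {y : V} (hy : y ∈ E) :
    compressionGram h E y = E.starProjection (h.adjoint (h y)) := by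
  simp [compressionGram, Submodule.starProjection_eq_self_iff.2 hy]

theorem mem_of_compressionGram_mem (h : V →L[ℝ] V) {E : Submodule ℝ V} {y : V}
    (hy : compressionGram h E y ∈ E) : y ∈ E := by
  have : y = compressionGram h E y - E.starProjection (h.adjoint (h y) - y) := by
    simp [compressionGram]
  rw [this]
  exact E.sub_mem hy (E.starProjection_apply_mem _)

/-- Modulo E the operator is the identity, so its kernel lies in E; there ⟨y, P_E h* h y⟩ = ‖h y‖².
Acting on all of V, it can be compared for different E, unlike the compression itself. -/
theorem isUnit_compressionGram {h : V →L[ℝ] V} (hh : Function.Injective h) (E : Submodule ℝ V) :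
    IsUnit (compressionGram h E) := by
  apply ContinuousLinearMap.isUnit_of_injective
  rw [injective_iff_map_eq_zero]
  intro y hy
  have hyE : y ∈ E := mem_of_compressionGram_mem h (by rw [hy]; exact E.zero_mem)
  rw [compressionGram_apply_of_mem h hyE] at hy
  apply (injective_iff_map_eq_zero h).1 hh
  rw [← inner_self_eq_zero (𝕜 := ℝ), ← ContinuousLinearMap.adjoint_inner_right,
    ← Submodule.starProjection_eq_self_iff.2 hyE, Submodule.inner_starProjection_left_eq_right,
    Submodule.starProjection_eq_self_iff.2 hyE, hy, inner_zero_right]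

/-- Least squares: the projection of v to hE is hy, where y in E solves P_E h* h y = P_E h* v. The
formula involves E only through its projection, which yields `Gr.measurable_map`. -/
theorem Submodule.starProjection_map_of_injective {h : V →L[ℝ] V} (hh : Function.Injective h)
    (E : Submodule ℝ V) :
    (E.map (h : V →ₗ[ℝ] V)).starProjection =
      h * Ring.inverse (compressionGram h E) * E.starProjection * h.adjoint := by
  ext1 v
  have h1 := Ring.mul_inverse_cancel _ (isUnit_compressionGram hh E)
  have h2 := DFunLike.congr_fun h1 (E.starProjection (h.adjoint v))
  simp only [mul_apply_eq_comp, one_apply_eq_self] at h2 ⊢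
  set y := Ring.inverse (compressionGram h E) (E.starProjection (h.adjoint v))
  have hyE : y ∈ E := mem_of_compressionGram_mem h (by
    rw [h2]; exact E.starProjection_apply_mem _)
  rw [compressionGram_apply_of_mem h hyE] at h2
  refine Submodule.eq_starProjection_of_mem_orthogonal ⟨y, hyE, rfl⟩ ?_
  rw [Submodule.mem_orthogonal]
  rintro _ ⟨e, he, rfl⟩
  have : inner ℝ (h e) (v - h y) = 0 := by
    rw [← ContinuousLinearMap.adjoint_inner_right, ← Submodule.starProjection_eq_self_iff.2 he,
      Submodule.inner_starProjection_left_eq_right, map_sub, map_sub, h2, sub_self,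
      inner_zero_right]
  exact this

/-- The Gram determinant of h on E is the determinant over E of 1 + P_E (h* h - 1); the identity
det(1 + AB) = det(1 + BA) moves it to V. -/
theorem normDet_domRestrict_sq (h : V →L[ℝ] V) (E : Submodule ℝ V) :
    ((h : V →ₗ[ℝ] V).domRestrict E).normDet ^ 2 = (compressionGram h E).det := by
  have h1 := (h ∘L E.subtypeL).normDet_sq
  have h2 : (h ∘L E.subtypeL).adjoint ∘L (h ∘L E.subtypeL) =
      1 + (E.orthogonalProjectionOnto ∘L (h.adjoint * h - 1)) ∘L E.subtypeL := by
    rw [ContinuousLinearMap.adjoint_comp, Submodule.adjoint_subtypeL]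
    ext x
    simp
  have h3 := LinearMap.det_one_add_comp_comm E.subtype
    (E.orthogonalProjectionOnto ∘L (h.adjoint * h - 1) : V →L[ℝ] E).toLinearMap
  rw [h2] at h1
  exact h1.trans h3.symm

end Projections

/-! ### Lebesgue measure on spaces of linear maps and orbit averages. -/

section HomMeasure

variable {F V : Type*} [NormedAddCommGroup F] [InnerProductSpace ℝ F] [FiniteDimensional ℝ F]
  [CompleteSpace F]
  [NormedAddCommGroup V] [InnerProductSpace ℝ V] [FiniteDimensional ℝ V] [CompleteSpace V]

theorem lintegral_comp_postcomp (ν : Measure (F →L[ℝ] V)) [ν.IsAddHaarMeasure] {g : V →L[ℝ] V}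
    (hg : g.det ≠ 0) (f : (F →L[ℝ] V) → ℝ≥0∞) :
    ∫⁻ X, f (g ∘L X) ∂ν = ENNReal.ofReal (|g.det|⁻¹ ^ finrank ℝ F) * ∫⁻ X, f X ∂ν := by
  have h := det_compL (F := F) g
  have h0 : LinearMap.det
      (ContinuousLinearMap.compL ℝ F V V g : (F →L[ℝ] V) →ₗ[ℝ] (F →L[ℝ] V)) ≠ 0 := by
    rw [h]; exact pow_ne_zero _ hg
  have h2 := lintegral_comp_linearEquiv ν (LinearMap.equivOfDetNeZero _ h0) f
  have h3 : LinearMap.det (LinearMap.equivOfDetNeZero _ h0 : (F →L[ℝ] V) →ₗ[ℝ] (F →L[ℝ] V)) =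
    g.det ^ finrank ℝ F := h
  rw [h3, abs_pow, ← inv_pow] at h2
  exact h2

theorem lintegral_comp_precomp (ν : Measure (F →L[ℝ] V)) [ν.IsAddHaarMeasure] {A : F →L[ℝ] F}
    (hA : A.det ≠ 0) (f : (F →L[ℝ] V) → ℝ≥0∞) :
    ∫⁻ X, f (X ∘L A) ∂ν = ENNReal.ofReal (|A.det|⁻¹ ^ finrank ℝ V) * ∫⁻ X, f X ∂ν := by
  have h := det_flip_compL (V := V) A
  have h0 : LinearMap.det
      ((ContinuousLinearMap.compL ℝ F F V).flip A : (F →L[ℝ] V) →ₗ[ℝ] (F →L[ℝ] V)) ≠ 0 := by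
    rw [h]; exact pow_ne_zero _ hA
  have h2 := lintegral_comp_linearEquiv ν (LinearMap.equivOfDetNeZero _ h0) f
  have h3 : LinearMap.det (LinearMap.equivOfDetNeZero _ h0 : (F →L[ℝ] V) →ₗ[ℝ] (F →L[ℝ] V)) =
    A.det ^ finrank ℝ V := h
  rw [h3, abs_pow, ← inv_pow] at h2
  exact h2

/-- Fix Y with left inverse T'. On each line X + tY the operator T'(X + tY) = T'X + t is singular
only when t is an eigenvalue of -T'X, that is, for finitely many t. -/
theorem ae_injective (ν : Measure (F →L[ℝ] V)) [ν.IsAddHaarMeasure]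
    (h : finrank ℝ F ≤ finrank ℝ V) : ∀ᵐ X : F →L[ℝ] V ∂ν, Function.Injective X := by
  have : ProperSpace (F →L[ℝ] V) := FiniteDimensional.proper_real _
  obtain ⟨X₀, hX₀⟩ := finrank_le_iff_exists_linearMap.1 h
  obtain ⟨T, hT⟩ := X₀.exists_leftInverse_of_injective (LinearMap.ker_eq_bot.2 hX₀)
  let T' : V →L[ℝ] F := LinearMap.toContinuousLinearMap T
  let Y : F →L[ℝ] V := LinearMap.toContinuousLinearMap X₀
  have hTY : T' ∘L Y = 1 := by
    ext1 x; exact LinearMap.congr_fun hT x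
  let s : Set (F →L[ℝ] V) := {X | IsUnit (T' ∘L X)}
  have hc : Continuous fun X : F →L[ℝ] V => T' ∘L X := continuous_const.clm_comp continuous_id
  have hs : MeasurableSet s := (Units.isOpen.preimage hc).measurableSet
  have key : ∀ᵐ X ∂ν, X ∈ s := by
    refine ae_mem_of_ae_add_linearMap_mem (LinearMap.toSpanSingleton ℝ _ Y) volume ν hs fun X => ?_
    have hfin := (Module.End.finite_hasEigenvalue (-(T' ∘L X : F →L[ℝ] F) : F →ₗ[ℝ] F))
    refine Filter.mem_of_superset (hfin.measure_zero volume |> compl_mem_ae_iff.2) fun t ht => ?_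
    refine ContinuousLinearMap.isUnit_of_injective ?_
    rw [injective_iff_map_eq_zero]
    intro x hx
    by_contra hx0
    refine ht (Module.End.hasEigenvalue_of_hasEigenvector (x := x) ⟨?_, hx0⟩)
    rw [Module.End.mem_eigenspace_iff]
    have h1 : T' (X x) + t • x = 0 := by
      have := DFunLike.congr_fun hTY x
      simp only [ContinuousLinearMap.comp_apply, one_apply_eq_self] at this
      simpa [this] using hx
    have : -(T' (X x)) = t • x := by rw [neg_eq_iff_add_eq_zero, h1]
    exact this
  filter_upwards [key] with X hX
  have := (ContinuousLinearMap.isUnit_iff_bijective.1 hX).1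
  exact Function.Injective.of_comp (f := T') this

theorem ae_isUnit (η : Measure (F →L[ℝ] F)) [η.IsAddHaarMeasure] : ∀ᵐ A ∂η, IsUnit A := by
  filter_upwards [ae_injective η le_rfl] with A hA
  exact ContinuousLinearMap.isUnit_of_injective hA

theorem ContinuousLinearMap.det_ne_zero_of_isUnit {A : F →L[ℝ] F} (hA : IsUnit A) : A.det ≠ 0 := by
  rw [ContinuousLinearMap.isUnit_iff_bijective] at hA
  exact (LinearEquiv.ofBijective (A : F →ₗ[ℝ] F) hA).isUnit_det'.ne_zero

/-- The density of the Haar measure of the general linear group with respect to the Lebesgue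
measure. -/
noncomputable def glDensity (A : F →L[ℝ] F) : ℝ≥0∞ :=
  ENNReal.ofReal (|A.det|⁻¹ ^ finrank ℝ F)

theorem measurable_glDensity : Measurable (glDensity (F := F)) :=
  ((ContinuousLinearMap.continuous_det.abs.measurable.inv).pow_const _).ennreal_ofReal

theorem ContinuousLinearMap.det_comp (A B : F →L[ℝ] F) : (A ∘L B).det = A.det * B.det :=
  LinearMap.det_comp _ _

theorem lintegral_glDensity_mul_left (η : Measure (F →L[ℝ] F)) [η.IsAddHaarMeasure]
    {R : F →L[ℝ] F} (hR : IsUnit R) (f : (F →L[ℝ] F) → ℝ≥0∞) :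
    ∫⁻ A, f (R ∘L A) * glDensity A ∂η = ∫⁻ A, f A * glDensity A ∂η := by
  have hd := ContinuousLinearMap.det_ne_zero_of_isUnit hR
  have hd' : 0 < |R.det| ^ finrank ℝ F := pow_pos (abs_pos.2 hd) _
  have h := lintegral_comp_postcomp η hd fun A => f A * glDensity A
  have h1 : ∀ A, glDensity (R ∘L A) = ENNReal.ofReal (|R.det|⁻¹ ^ finrank ℝ F) * glDensity A := by
    intro A
    rw [glDensity, ContinuousLinearMap.det_comp, abs_mul, mul_inv, mul_pow,
      ENNReal.ofReal_mul (by positivity), glDensity]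
  simp only [h1, mul_left_comm (f _)] at h
  rw [lintegral_const_mul' _ _ ENNReal.ofReal_ne_top] at h
  exact (ENNReal.mul_right_inj (by simpa using (by positivity)) ENNReal.ofReal_ne_top).1 h

theorem lintegral_glDensity_mul_right (η : Measure (F →L[ℝ] F)) [η.IsAddHaarMeasure]
    {R : F →L[ℝ] F} (hR : IsUnit R) (f : (F →L[ℝ] F) → ℝ≥0∞) :
    ∫⁻ A, f (A ∘L R) * glDensity A ∂η = ∫⁻ A, f A * glDensity A ∂η := by
  have hd := ContinuousLinearMap.det_ne_zero_of_isUnit hR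
  have hd' : 0 < |R.det| ^ finrank ℝ F := pow_pos (abs_pos.2 hd) _
  have h := lintegral_comp_precomp η hd fun A => f A * glDensity A
  have h1 : ∀ A, glDensity (A ∘L R) = ENNReal.ofReal (|R.det|⁻¹ ^ finrank ℝ F) * glDensity A := by
    intro A
    rw [glDensity, ContinuousLinearMap.det_comp, mul_comm, abs_mul, mul_inv, mul_pow,
      ENNReal.ofReal_mul (by positivity), glDensity]
  simp only [h1, mul_left_comm (f _)] at h
  rw [lintegral_const_mul' _ _ ENNReal.ofReal_ne_top] at h
  exact (ENNReal.mul_right_inj (by simpa using (by positivity)) ENNReal.ofReal_ne_top).1 h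

theorem measurable_ringInverse : Measurable (Ring.inverse : (F →L[ℝ] F) → (F →L[ℝ] F)) := by
  classical
  let s : Set (F →L[ℝ] F) := {A | IsUnit A}
  have h : (Ring.inverse : (F →L[ℝ] F) → (F →L[ℝ] F)) = s.piecewise Ring.inverse 0 := by
    funext A
    by_cases hA : A ∈ s
    · rw [Set.piecewise_eq_of_mem _ _ _ hA]
    · rw [Set.piecewise_eq_of_notMem _ _ _ hA]
      exact Ring.inverse_non_unit A hA
  rw [h]
  refine ContinuousOn.measurable_piecewise ?_ continuousOn_const Units.isOpen.measurableSet
  rintro _ ⟨u, rfl⟩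
  exact (NormedRing.inverse_continuousAt u).continuousWithinAt

/-- Integrate H₁(X) Φ(X) H₂(XA) over X and over GL(F) with its Haar measure. Integrating in A first
gives one side; substituting X ↦ XA⁻¹ first gives the other. Averaging H₁ along A⁻¹ avoids the
inversion invariance of Haar measure. -/
theorem lintegral_mul_eq_of_average_eq (ν : Measure (F →L[ℝ] V)) [ν.IsAddHaarMeasure]
    (η : Measure (F →L[ℝ] F)) [η.IsAddHaarMeasure] {H₁ H₂ Φ : (F →L[ℝ] V) → ℝ≥0∞}
    (hH₁ : Measurable H₁) (hH₂ : Measurable H₂) (hΦ : Measurable Φ) {c c' : ℝ≥0∞}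
    (h₁ : ∀ᵐ X ∂ν, ∫⁻ A, H₁ (X ∘L Ring.inverse A) * glDensity A ∂η = c')
    (h₂ : ∀ᵐ X ∂ν, ∫⁻ A, H₂ (X ∘L A) * glDensity A ∂η = c)
    (hhom : ∀ (X : F →L[ℝ] V) (A : F →L[ℝ] F), IsUnit A →
      Φ (X ∘L A) = ENNReal.ofReal (|A.det|⁻¹ ^ finrank ℝ V) * Φ X) :
    c * ∫⁻ X, H₁ X * Φ X ∂ν = c' * ∫⁻ X, H₂ X * Φ X ∂ν := by
  have : ProperSpace (F →L[ℝ] V) := FiniteDimensional.proper_real _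
  have : ProperSpace (F →L[ℝ] F) := FiniteDimensional.proper_real _
  have mcomp : Measurable fun q : (F →L[ℝ] V) × (F →L[ℝ] F) => q.1 ∘L q.2 :=
    (continuous_fst.clm_comp continuous_snd).measurable
  have minv : Measurable fun q : (F →L[ℝ] V) × (F →L[ℝ] F) => q.1 ∘L Ring.inverse q.2 :=
    mcomp.comp (measurable_fst.prodMk (measurable_ringInverse.comp measurable_snd))
  have mw : Measurable fun q : (F →L[ℝ] V) × (F →L[ℝ] F) => glDensity q.2 :=
    measurable_glDensity.comp measurable_snd
  calc c * ∫⁻ X, H₁ X * Φ X ∂ν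
      = ∫⁻ X, ∫⁻ A, H₁ X * Φ X * (H₂ (X ∘L A) * glDensity A) ∂η ∂ν := by
        have hm : Measurable fun X => H₁ X * Φ X := hH₁.mul hΦ
        rw [← lintegral_const_mul _ hm]
        refine lintegral_congr_ae ?_
        filter_upwards [h₂] with X hX
        rw [lintegral_const_mul _ (by
          exact (hH₂.comp (mcomp.comp measurable_prodMk_left)).mul measurable_glDensity), hX,
          mul_comm]
    _ = ∫⁻ A, ∫⁻ X, H₁ X * Φ X * (H₂ (X ∘L A) * glDensity A) ∂ν ∂η := by
        refine lintegral_lintegral_swap (Measurable.aemeasurable ?_)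
        exact ((hH₁.mul hΦ).comp measurable_fst).mul ((hH₂.comp mcomp).mul mw)
    _ = ∫⁻ A, ∫⁻ X, H₂ X * Φ X * (H₁ (X ∘L Ring.inverse A) * glDensity A) ∂ν ∂η := by
        refine lintegral_congr_ae ?_
        filter_upwards [ae_isUnit η] with A hA
        have hd := ContinuousLinearMap.det_ne_zero_of_isUnit hA
        have hd' : 0 < |A.det| := abs_pos.2 hd
        have hAA : ∀ X : F →L[ℝ] V, (X ∘L A) ∘L Ring.inverse A = X := fun X => by
          have : A ∘L Ring.inverse A = 1 := Ring.mul_inverse_cancel A hA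
          rw [ContinuousLinearMap.comp_assoc, this]; rfl
        -- The Jacobian of X ↦ XA and the homogeneity of Φ give the same factor, which is nonzero
        -- and finite and so cancels.
        have h := lintegral_comp_precomp ν hd
          fun X => H₂ X * Φ X * (H₁ (X ∘L Ring.inverse A) * glDensity A)
        simp only [hAA, hhom _ A hA] at h
        set r := ENNReal.ofReal (|A.det|⁻¹ ^ finrank ℝ V) with hr
        have hr0 : r ≠ 0 := by
          rw [hr]; simpa using (by positivity)
        have hrt : r ≠ ∞ := ENNReal.ofReal_ne_top
        rw [← ENNReal.mul_right_inj hr0 hrt, ← h, ← lintegral_const_mul' _ _ hrt]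
        refine lintegral_congr fun X => ?_
        ring
    _ = ∫⁻ X, ∫⁻ A, H₂ X * Φ X * (H₁ (X ∘L Ring.inverse A) * glDensity A) ∂η ∂ν := by
        refine (lintegral_lintegral_swap (Measurable.aemeasurable ?_)).symm
        exact ((hH₂.mul hΦ).comp measurable_fst).mul ((hH₁.comp minv).mul mw)
    _ = c' * ∫⁻ X, H₂ X * Φ X ∂ν := by
        have hm : Measurable fun X => H₂ X * Φ X := hH₂.mul hΦ
        rw [← lintegral_const_mul _ hm]
        refine lintegral_congr_ae ?_
        filter_upwards [h₁] with X hX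
        rw [lintegral_const_mul _ (by
          exact (hH₁.comp (minv.comp measurable_prodMk_left)).mul measurable_glDensity), hX,
          mul_comm]

end HomMeasure

/-! ### A cut-off weight with constant orbit averages. -/

section BallWeight

variable {F V : Type*} [NormedAddCommGroup F] [InnerProductSpace ℝ F] [FiniteDimensional ℝ F]
  [CompleteSpace F]
  [NormedAddCommGroup V] [InnerProductSpace ℝ V] [FiniteDimensional ℝ V] [CompleteSpace V]

theorem continuous_normDet : Continuous fun X : F →L[ℝ] V => (X : F →ₗ[ℝ] V).normDet := by
  have h : (fun X : F →L[ℝ] V => (X : F →ₗ[ℝ] V).normDet) =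
      fun X => √(X.adjoint ∘L X).det := by
    funext X
    have h1 : (X : F →ₗ[ℝ] V).normDet ^ 2 = (X.adjoint ∘L X).det := X.normDet_sq
    rw [← h1, Real.sqrt_sq (LinearMap.normDet_nonneg _)]
  rw [h]
  exact (ContinuousLinearMap.continuous_det.comp
    ((ContinuousLinearMap.adjoint.continuous).clm_comp continuous_id)).sqrt

theorem normDet_comp_endomorphism (X : F →L[ℝ] V) (A : F →L[ℝ] F) :
    (X ∘L A : F →ₗ[ℝ] V).normDet = (X : F →ₗ[ℝ] V).normDet * |A.det| := by
  have h := LinearMap.normDet_comp_of_finrank_eq (A : F →ₗ[ℝ] F) (X : F →ₗ[ℝ] V) rfl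
  rw [LinearMap.normDet_eq_abs_det (A : F →ₗ[ℝ] F)] at h
  exact h

theorem normDet_pos_of_injective {X : F →L[ℝ] V} (hX : Function.Injective X) :
    0 < (X : F →ₗ[ℝ] V).normDet := by
  refine lt_of_le_of_ne (LinearMap.normDet_nonneg _) (Ne.symm ?_)
  exact ((X : F →ₗ[ℝ] V).normDet_ne_zero_tfae.out 0 4).2 hX

theorem exists_isometry_comp_of_injective {X : F →L[ℝ] V} (hX : Function.Injective X) :
    ∃ (Q : F →ₗᵢ[ℝ] V) (R : F →L[ℝ] F), IsUnit R ∧ X = Q.toContinuousLinearMap ∘L R := by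
  let e : F ≃ₗ[ℝ] X.range := LinearEquiv.ofInjective (X : F →ₗ[ℝ] V) hX
  let Q : F ≃ₗᵢ[ℝ] X.range := (stdOrthonormalBasis ℝ F).equiv (stdOrthonormalBasis ℝ X.range)
    (finCongr e.finrank_eq)
  let R : F ≃ₗ[ℝ] F := e.trans Q.symm.toLinearEquiv
  refine ⟨X.range.subtypeₗᵢ.comp Q.toLinearIsometry, LinearMap.toContinuousLinearMap R,
    ContinuousLinearMap.isUnit_of_injective R.injective, ?_⟩
  ext1 x
  have h : Q (R x) = e x := by simp [R]
  exact (congrArg Subtype.val h).symm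

/-- The `m`-th power of the norm determinant, cut off to the unit ball of the operator norm. -/
noncomputable def ballWeight (m : ℕ) : (F →L[ℝ] V) → ℝ≥0∞ :=
  (Metric.closedBall 0 1).indicator fun X => ENNReal.ofReal ((X : F →ₗ[ℝ] V).normDet ^ m)

theorem measurable_ballWeight (m : ℕ) : Measurable (ballWeight m : (F →L[ℝ] V) → ℝ≥0∞) :=
  ((continuous_normDet.pow m).measurable.ennreal_ofReal).indicator
    Metric.isClosed_closedBall.measurableSet

theorem ballWeight_isometry_comp (m : ℕ) (Q : F →ₗᵢ[ℝ] V) (B : F →L[ℝ] F) :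
    ballWeight m (Q.toContinuousLinearMap ∘L B) = ballWeight m B := by
  have h1 : ‖Q.toContinuousLinearMap ∘L B‖ = ‖B‖ := Q.norm_toContinuousLinearMap_comp
  have h2 : (Q.toContinuousLinearMap ∘L B : F →ₗ[ℝ] V).normDet = (B : F →ₗ[ℝ] F).normDet := by
    rw [normDet_comp_endomorphism, LinearMap.normDet_eq_abs_det]
    have : (Q.toContinuousLinearMap : F →ₗ[ℝ] V).normDet = 1 := Q.normDet_eq_one
    rw [this, one_mul]
  simp only [ballWeight, Set.indicator, mem_closedBall_zero_iff, h1, h2]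

/-- Write X = QR with Q an isometry. The weight does not see Q, and left invariance absorbs R. -/
theorem lintegral_ballWeight_comp (η : Measure (F →L[ℝ] F)) [η.IsAddHaarMeasure] (m : ℕ)
    {X : F →L[ℝ] V} (hX : Function.Injective X) :
    ∫⁻ A, ballWeight m (X ∘L A) * glDensity A ∂η = ∫⁻ A, ballWeight m A * glDensity A ∂η := by
  obtain ⟨Q, R, hR, rfl⟩ := exists_isometry_comp_of_injective hX
  simp only [ContinuousLinearMap.comp_assoc, ballWeight_isometry_comp]
  exact lintegral_glDensity_mul_left η hR _

/-- Here R A⁻¹ = (A R⁻¹)⁻¹, so right invariance absorbs R. -/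
theorem lintegral_ballWeight_comp_inverse (η : Measure (F →L[ℝ] F)) [η.IsAddHaarMeasure] (m : ℕ)
    {X : F →L[ℝ] V} (hX : Function.Injective X) :
    ∫⁻ A, ballWeight m (X ∘L Ring.inverse A) * glDensity A ∂η =
      ∫⁻ A, ballWeight m (Ring.inverse A) * glDensity A ∂η := by
  obtain ⟨Q, R, hR, rfl⟩ := exists_isometry_comp_of_injective hX
  simp only [ContinuousLinearMap.comp_assoc, ballWeight_isometry_comp]
  obtain ⟨u, rfl⟩ := hR
  have h := lintegral_glDensity_mul_right η u⁻¹.isUnit fun A => ballWeight m (Ring.inverse A)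
  rw [← h]
  refine lintegral_congr_ae ?_
  filter_upwards [ae_isUnit η] with A hA
  obtain ⟨v, rfl⟩ := hA
  have : Ring.inverse ((v : F →L[ℝ] F) ∘L (u⁻¹ : (F →L[ℝ] F)ˣ)) =
      (u : F →L[ℝ] F) ∘L Ring.inverse (v : F →L[ℝ] F) := by
    have h1 : (v : F →L[ℝ] F) ∘L (u⁻¹ : (F →L[ℝ] F)ˣ) = ((v * u⁻¹ : (F →L[ℝ] F)ˣ) : F →L[ℝ] F) :=
      rfl
    rw [h1, Ring.inverse_unit, Ring.inverse_unit, mul_inv_rev, inv_inv]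
    rfl
  rw [this]

/-- The zero of normDet^m outweighs the pole of the Haar density, which makes the orbit average
finite. -/
theorem ballWeight_mul_glDensity_le {m : ℕ} (hm : finrank ℝ F ≤ m) (A : F →L[ℝ] F) :
    ballWeight m A * glDensity A ≤ (Metric.closedBall 0 1).indicator
      (fun A : F →L[ℝ] F => ENNReal.ofReal (|A.det| ^ (m - finrank ℝ F))) A := by
  by_cases hA : A ∈ Metric.closedBall (0 : F →L[ℝ] F) 1
  · rw [ballWeight, glDensity, Set.indicator_of_mem hA, Set.indicator_of_mem hA,
      LinearMap.normDet_eq_abs_det, ← ENNReal.ofReal_mul (by positivity)]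
    refine ENNReal.ofReal_le_ofReal ?_
    change |A.det| ^ m * |A.det|⁻¹ ^ finrank ℝ F ≤ |A.det| ^ (m - finrank ℝ F)
    nth_rw 1 [← Nat.sub_add_cancel hm]
    rw [pow_add, mul_assoc, ← mul_pow]
    -- Only an inequality: for singular A the inverse of the determinant is 0.
    exact mul_le_of_le_one_right (by positivity)
      (pow_le_one₀ (by positivity) (mul_inv_le_one))
  · simp [ballWeight, hA]

theorem lintegral_ballWeight_ne_top (η : Measure (F →L[ℝ] F)) [η.IsAddHaarMeasure] {m : ℕ}
    (hm : finrank ℝ F ≤ m) : ∫⁻ A, ballWeight m A * glDensity A ∂η ≠ ∞ := by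
  have : ProperSpace (F →L[ℝ] F) := FiniteDimensional.proper_real _
  have hc : Continuous fun A : F →L[ℝ] F => |A.det| ^ (m - finrank ℝ F) :=
    ContinuousLinearMap.continuous_det.abs.pow _
  have hi : IntegrableOn (fun A : F →L[ℝ] F => |A.det| ^ (m - finrank ℝ F))
      (Metric.closedBall 0 1) η :=
    hc.continuousOn.integrableOn_compact (isCompact_closedBall _ _)
  have h1 := lintegral_mono (μ := η) (ballWeight_mul_glDensity_le (F := F) hm)
  rw [lintegral_indicator Metric.isClosed_closedBall.measurableSet] at h1
  exact (h1.trans_lt hi.lintegral_lt_top).ne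

theorem lintegral_ballWeight_ne_zero (η : Measure (F →L[ℝ] F)) [η.IsAddHaarMeasure] (m : ℕ) :
    ∫⁻ A, ballWeight m A * glDensity A ∂η ≠ 0 := by
  intro h
  have hm : Measurable fun A : F →L[ℝ] F => ballWeight m A * glDensity A :=
    (measurable_ballWeight m).mul measurable_glDensity
  rw [lintegral_eq_zero_iff hm] at h
  refine (Metric.measure_ball_pos η (0 : F →L[ℝ] F) one_pos).ne' ?_
  refine measure_mono_null (fun A hA => ?_) (ae_iff.1 (h.and (ae_isUnit η)))
  rintro ⟨h0, hu⟩
  have hd : 0 < |A.det| := abs_pos.2 (ContinuousLinearMap.det_ne_zero_of_isUnit hu)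
  have hn : 0 < (A : F →ₗ[ℝ] F).normDet := by rwa [LinearMap.normDet_eq_abs_det]
  have h1 : 0 < ballWeight m A := by
    rw [ballWeight, Set.indicator_of_mem (Metric.ball_subset_closedBall hA), ENNReal.ofReal_pos]
    positivity
  have h2 : 0 < glDensity A := by
    rw [glDensity, ENNReal.ofReal_pos]
    positivity
  exact (ENNReal.mul_pos h1.ne' h2.ne').ne' h0

theorem lintegral_ballWeight_comp_mul (ν : Measure (F →L[ℝ] V)) [ν.IsAddHaarMeasure]
    (hFV : finrank ℝ F ≤ finrank ℝ V) {Φ : (F →L[ℝ] V) → ℝ≥0∞} (hΦ : Measurable Φ)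
    (hhom : ∀ (X : F →L[ℝ] V) (A : F →L[ℝ] F), IsUnit A →
      Φ (X ∘L A) = ENNReal.ofReal (|A.det|⁻¹ ^ finrank ℝ V) * Φ X)
    {g : V →L[ℝ] V} (hg : Function.Injective g) :
    ∫⁻ X, ballWeight (finrank ℝ V) (g ∘L X) * Φ X ∂ν =
      ∫⁻ X, ballWeight (finrank ℝ V) X * Φ X ∂ν := by
  have : ProperSpace (F →L[ℝ] F) := FiniteDimensional.proper_real _
  let η : Measure (F →L[ℝ] F) := Measure.addHaar
  have key : ∀ {g : V →L[ℝ] V}, Function.Injective g →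
      (∫⁻ A, ballWeight (finrank ℝ V) A * glDensity A ∂η) *
        ∫⁻ X, ballWeight (finrank ℝ V) (g ∘L X) * Φ X ∂ν =
      (∫⁻ A, ballWeight (finrank ℝ V) (Ring.inverse A) * glDensity A ∂η) *
        ∫⁻ X, ballWeight (finrank ℝ V) X * Φ X ∂ν := by
    intro g hg
    have hc : Continuous fun X : F →L[ℝ] V => g ∘L X := continuous_const.clm_comp continuous_id
    refine lintegral_mul_eq_of_average_eq ν η ((measurable_ballWeight _).comp hc.measurable)
      (measurable_ballWeight _) hΦ ?_ ?_ hhom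
    · filter_upwards [ae_injective ν hFV] with X hX
      have hgX : Function.Injective (g ∘L X) := hg.comp hX
      simpa only [ContinuousLinearMap.comp_assoc, Function.comp_apply] using
        lintegral_ballWeight_comp_inverse η (finrank ℝ V) hgX
    · filter_upwards [ae_injective ν hFV] with X hX
      exact lintegral_ballWeight_comp η _ hX
  -- The constant of the inverse average is the same for g and for the identity, so its value is not
  -- needed; only the direct average has to be cancelled.
  have h1 := key hg
  have h2 := key (g := ContinuousLinearMap.id ℝ V) Function.injective_id
  simp only [ContinuousLinearMap.id_comp] at h2
  rw [← h2] at h1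
  exact (ENNReal.mul_right_inj (lintegral_ballWeight_ne_zero η _)
    (lintegral_ballWeight_ne_top η hFV)).1 h1

end BallWeight

/-! ### The linear action on the Grassmannian and its parametrization by injective maps. -/

namespace Gr

variable {n k : ℕ}

theorem measurable_starProjection :
    Measurable fun E : Gr n k => E.1.starProjection :=
  continuous_induced_dom.measurable

theorem measurable_iff {α : Type*} [MeasurableSpace α] {f : α → Gr n k} :
    Measurable f ↔ Measurable fun a => (f a).1.starProjection := by
  refine ⟨fun h => measurable_starProjection.comp h, fun h => ?_⟩
  have h1 : instMeasurableSpace n k = MeasurableSpace.comap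
      (fun E : Gr n k => E.1.starProjection) (borel _) :=
    borel_comap (f := fun E : Gr n k => E.1.starProjection)
  rw [measurable_iff_comap_le, h1, MeasurableSpace.comap_comp]
  exact measurable_iff_comap_le.1 h

/-- The action of linear isomorphisms on the Grassmannian. -/
noncomputable def map (h : EuclideanSpace ℝ (Fin n) ≃L[ℝ] EuclideanSpace ℝ (Fin n))
    (E : Gr n k) : Gr n k :=
  ⟨E.1.map (h : EuclideanSpace ℝ (Fin n) →L[ℝ] EuclideanSpace ℝ (Fin n)).toLinearMap,
    (h.toLinearEquiv.finrank_map_eq E.1).trans E.2⟩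

theorem continuous_compressionGram
    (h : EuclideanSpace ℝ (Fin n) →L[ℝ] EuclideanSpace ℝ (Fin n)) :
    Continuous fun E : Gr n k => compressionGram h E.1 :=
  continuous_const.add (continuous_induced_dom.mul continuous_const)

theorem measurable_map (h : EuclideanSpace ℝ (Fin n) ≃L[ℝ] EuclideanSpace ℝ (Fin n)) :
    Measurable (map h : Gr n k → Gr n k) := by
  refine measurable_iff.2 ?_
  have h1 : (fun E : Gr n k => (map h E).1.starProjection) = fun E =>
      (h : EuclideanSpace ℝ (Fin n) →L[ℝ] EuclideanSpace ℝ (Fin n)) *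
        Ring.inverse (compressionGram h E.1) * E.1.starProjection *
        (h : EuclideanSpace ℝ (Fin n) →L[ℝ] EuclideanSpace ℝ (Fin n)).adjoint := by
    funext E
    exact Submodule.starProjection_map_of_injective h.injective E.1
  rw [h1]
  have h2 : Measurable fun E : Gr n k => Ring.inverse
      (compressionGram (h : EuclideanSpace ℝ (Fin n) →L[ℝ] EuclideanSpace ℝ (Fin n)) E.1) :=
    measurable_ringInverse.comp (continuous_compressionGram _).measurable
  exact ((measurable_const.mul h2).mul measurable_starProjection).mul measurable_const

theorem map_symm_map (h : EuclideanSpace ℝ (Fin n) ≃L[ℝ] EuclideanSpace ℝ (Fin n)) (E : Gr n k) :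
    map h.symm (map h E) = E := by
  refine Subtype.ext ?_
  change Submodule.map _ (Submodule.map _ E.1) = E.1
  rw [← Submodule.map_comp]
  convert Submodule.map_id E.1
  ext x
  simp

/-- The action of a linear isomorphism on the Grassmannian as a measurable equivalence. -/
noncomputable def mapEquiv (h : EuclideanSpace ℝ (Fin n) ≃L[ℝ] EuclideanSpace ℝ (Fin n)) :
    Gr n k ≃ᵐ Gr n k where
  toFun := map h
  invFun := map h.symm
  left_inv := map_symm_map h
  right_inv := map_symm_map h.symm
  measurable_toFun := measurable_map h
  measurable_invFun := measurable_map h.symm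

/-- The factor by which a linear isomorphism multiplies `k`-dimensional volumes in `E`. -/
noncomputable def volumeFactor (h : EuclideanSpace ℝ (Fin n) ≃L[ℝ] EuclideanSpace ℝ (Fin n))
    (E : Gr n k) : ℝ :=
  ((h : EuclideanSpace ℝ (Fin n) →L[ℝ] EuclideanSpace ℝ (Fin n)).toLinearMap.domRestrict
    E.1).normDet

theorem measurable_volumeFactor
    (h : EuclideanSpace ℝ (Fin n) ≃L[ℝ] EuclideanSpace ℝ (Fin n)) :
    Measurable (volumeFactor h : Gr n k → ℝ) := by
  have h1 : (volumeFactor h : Gr n k → ℝ) = fun E => √(compressionGram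
      (h : EuclideanSpace ℝ (Fin n) →L[ℝ] EuclideanSpace ℝ (Fin n)) E.1).det := by
    funext E
    rw [← normDet_domRestrict_sq, Real.sqrt_sq (LinearMap.normDet_nonneg _)]
    rfl
  rw [h1]
  exact (ContinuousLinearMap.continuous_det.comp (continuous_compressionGram _)).sqrt.measurable

theorem volumeFactor_pos (h : EuclideanSpace ℝ (Fin n) ≃L[ℝ] EuclideanSpace ℝ (Fin n))
    (E : Gr n k) : 0 < volumeFactor h E := by
  refine lt_of_le_of_ne (LinearMap.normDet_nonneg _) (Ne.symm ?_)
  refine (LinearMap.normDet_ne_zero_tfae _).out 0 4 |>.2 ?_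
  exact h.injective.comp Subtype.val_injective

theorem lintegral_map_eq (h : EuclideanSpace ℝ (Fin n) ≃L[ℝ] EuclideanSpace ℝ (Fin n))
    (E : Gr n k) (f : EuclideanSpace ℝ (Fin n) → ℝ≥0∞) :
    ∫⁻ t : (map h E).1, f t = ENNReal.ofReal (volumeFactor h E) * ∫⁻ t : E.1, f (h t) := by
  let e : E.1 ≃ₗ[ℝ] (map h E).1 := h.toLinearEquiv.submoduleMap E.1
  have h1 := lintegral_eq_normDet_mul_lintegral_comp e fun t => f t
  have h2 : (e : E.1 →ₗ[ℝ] (map h E).1).normDet = volumeFactor h E :=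
    LinearMap.normDet_codRestrict (p := (map h E).1) (f := (h :
      EuclideanSpace ℝ (Fin n) →L[ℝ] EuclideanSpace ℝ (Fin n)).toLinearMap.domRestrict E.1)
      fun c => ⟨c, c.2, rfl⟩
  rw [h2] at h1
  exact h1

/-- The range of an injective linear map `ℝᵏ → ℝⁿ`, as a point of the Grassmannian. -/
noncomputable def ofInjective (X : EuclideanSpace ℝ (Fin k) →L[ℝ] EuclideanSpace ℝ (Fin n))
    (hX : Function.Injective X) : Gr n k :=
  ⟨X.range, (LinearMap.finrank_range_of_inj hX).trans finrank_euclideanSpace_fin⟩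

open Classical in
/-- The range of an injective linear map `ℝᵏ → ℝⁿ`, as a point of the Grassmannian; other linear
maps are sent to the coordinate subspace. -/
noncomputable def ofMap (hk : k ≤ n) (X : EuclideanSpace ℝ (Fin k) →L[ℝ] EuclideanSpace ℝ (Fin n)) :
    Gr n k :=
  if hX : Function.Injective X then ofInjective X hX else coordSubspace hk

theorem ofMap_of_injective (hk : k ≤ n)
    {X : EuclideanSpace ℝ (Fin k) →L[ℝ] EuclideanSpace ℝ (Fin n)}
    (hX : Function.Injective X) : ofMap hk X = ofInjective X hX := by
  rw [ofMap, dif_pos hX]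

theorem ofMap_of_not_injective (hk : k ≤ n)
    {X : EuclideanSpace ℝ (Fin k) →L[ℝ] EuclideanSpace ℝ (Fin n)}
    (hX : ¬ Function.Injective X) : ofMap hk X = coordSubspace hk := by
  rw [ofMap, dif_neg hX]

theorem measurable_ofMap (hk : k ≤ n) : Measurable (ofMap hk) := by
  classical
  refine measurable_iff.2 ?_
  let s : Set (EuclideanSpace ℝ (Fin k) →L[ℝ] EuclideanSpace ℝ (Fin n)) :=
    {X | Function.Injective X}
  -- Injectivity of X is invertibility of X* X, an open condition.
  have hs : s = {X | IsUnit (X.adjoint ∘L X)} := by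
    ext X
    refine ⟨fun h => ContinuousLinearMap.adjoint_comp_self_isUnit h, fun h => ?_⟩
    exact Function.Injective.of_comp (f := X.adjoint)
      (ContinuousLinearMap.isUnit_iff_bijective.1 h).1
  have hc : Continuous fun X : EuclideanSpace ℝ (Fin k) →L[ℝ] EuclideanSpace ℝ (Fin n) =>
      X.adjoint ∘L X := ContinuousLinearMap.adjoint.continuous.clm_comp continuous_id
  have hm : MeasurableSet s := by
    rw [hs]; exact (Units.isOpen.preimage hc).measurableSet
  have h1 : (fun X => (ofMap hk X).1.starProjection) = s.piecewise
      (fun X => X ∘L Ring.inverse (X.adjoint ∘L X) ∘L X.adjoint)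
      (fun _ => (coordSubspace hk).1.starProjection) := by
    funext X
    by_cases hX : X ∈ s
    · rw [Set.piecewise_eq_of_mem _ _ _ hX, ← Submodule.starProjection_range hX]
      rw [ofMap_of_injective hk hX]
      rfl
    · rw [Set.piecewise_eq_of_notMem _ _ _ hX, ofMap_of_not_injective hk hX]
  rw [h1]
  refine ContinuousOn.measurable_piecewise ?_ continuousOn_const hm
  intro X hX
  obtain ⟨u, hu⟩ := ContinuousLinearMap.adjoint_comp_self_isUnit hX
  have hi : ContinuousAt (fun X : EuclideanSpace ℝ (Fin k) →L[ℝ] EuclideanSpace ℝ (Fin n) =>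
      Ring.inverse (X.adjoint ∘L X)) X := by
    refine ContinuousAt.comp (g := Ring.inverse) ?_ hc.continuousAt
    rw [← hu]
    exact NormedRing.inverse_continuousAt u
  exact (continuousAt_id.clm_comp
    (hi.clm_comp ContinuousLinearMap.adjoint.continuous.continuousAt)).continuousWithinAt

theorem ofMap_comp (hk : k ≤ n) (X : EuclideanSpace ℝ (Fin k) →L[ℝ] EuclideanSpace ℝ (Fin n))
    {A : EuclideanSpace ℝ (Fin k) →L[ℝ] EuclideanSpace ℝ (Fin k)} (hA : IsUnit A) :
    ofMap hk (X ∘L A) = ofMap hk X := by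
  have hA' := ContinuousLinearMap.isUnit_iff_bijective.1 hA
  by_cases hX : Function.Injective X
  · have hXA : Function.Injective (X ∘L A) := hX.comp hA'.1
    rw [ofMap_of_injective hk hX, ofMap_of_injective hk hXA]
    refine Subtype.ext ?_
    exact LinearMap.range_comp_of_range_eq_top _ (LinearMap.range_eq_top.2 hA'.2)
  · have hXA : ¬ Function.Injective (X ∘L A) := fun h => hX
      ((Function.Injective.of_comp_iff' X hA').1 h)
    rw [ofMap_of_not_injective hk hX, ofMap_of_not_injective hk hXA]

theorem ofMap_postcomp (hk : k ≤ n)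
    {X : EuclideanSpace ℝ (Fin k) →L[ℝ] EuclideanSpace ℝ (Fin n)} (hX : Function.Injective X)
    (h : EuclideanSpace ℝ (Fin n) ≃L[ℝ] EuclideanSpace ℝ (Fin n)) :
    ofMap hk ((h : EuclideanSpace ℝ (Fin n) →L[ℝ] EuclideanSpace ℝ (Fin n)) ∘L X) =
      map h (ofMap hk X) := by
  have hhX : Function.Injective
    ((h : EuclideanSpace ℝ (Fin n) →L[ℝ] EuclideanSpace ℝ (Fin n)) ∘L X) := h.injective.comp hX
  rw [ofMap_of_injective hk hX, ofMap_of_injective hk hhX]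
  refine Subtype.ext ?_
  exact LinearMap.range_comp _ _

theorem normDet_postcomp (hk : k ≤ n)
    {X : EuclideanSpace ℝ (Fin k) →L[ℝ] EuclideanSpace ℝ (Fin n)} (hX : Function.Injective X)
    (h : EuclideanSpace ℝ (Fin n) ≃L[ℝ] EuclideanSpace ℝ (Fin n)) :
    ((h : EuclideanSpace ℝ (Fin n) →L[ℝ] EuclideanSpace ℝ (Fin n)) ∘L X).toLinearMap.normDet =
      volumeFactor h (ofMap hk X) * X.toLinearMap.normDet := by
  rw [ofMap_of_injective hk hX]
  exact LinearMap.normDet_comp _ _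

end Gr

/-! ### Invariance of the Haar measures. -/

instance OrthGroup.instIsHaarMeasure (n : ℕ) : (OrthGroup.haarProb n).IsHaarMeasure := by
  unfold OrthGroup.haarProb
  infer_instance

instance OrthGroup.instIsMulRightInvariant (n : ℕ) :
    (OrthGroup.haarProb n).IsMulRightInvariant := by
  refine ⟨fun U => ?_⟩
  have : IsProbabilityMeasure ((OrthGroup.haarProb n).map (· * U)) :=
    Measure.isProbabilityMeasure_map (continuous_mul_const U).measurable.aemeasurable
  have : ((OrthGroup.haarProb n).map (· * U)).IsHaarMeasure :=
    Measure.isHaarMeasure_map_mul_right _ U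
  exact Measure.isHaarMeasure_eq_of_isProbabilityMeasure _ _

namespace Gr

variable {n k : ℕ}

/-- An element of the orthogonal group, as a linear isomorphism. -/
noncomputable def orthEquiv (U : OrthGroup n) :
    EuclideanSpace ℝ (Fin n) ≃L[ℝ] EuclideanSpace ℝ (Fin n) :=
  (Unitary.linearIsometryEquiv U).toContinuousLinearEquiv

theorem rotate_eq_map (U : OrthGroup n) (E : Gr n k) : rotate U E = map (orthEquiv U) E := rfl

theorem abs_det_orthEquiv (U : OrthGroup n) :
    |(orthEquiv U : EuclideanSpace ℝ (Fin n) →L[ℝ] EuclideanSpace ℝ (Fin n)).det| = 1 := by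
  have h := (Unitary.linearIsometryEquiv U).toLinearIsometry.normDet_eq_one
  rw [LinearMap.normDet_eq_abs_det] at h
  exact h

theorem rotate_mul (U W : OrthGroup n) (E : Gr n k) : rotate (U * W) E = rotate U (rotate W E) := by
  refine Subtype.ext ?_
  change Submodule.map _ _ = Submodule.map _ (Submodule.map _ _)
  rw [← Submodule.map_comp]
  rfl

/-- An isometry from E to E' extends to the whole Euclidean space. -/
theorem exists_rotate_eq (E E' : Gr n k) : ∃ U : OrthGroup n, rotate U E = E' := by
  let L : E.1 ≃ₗᵢ[ℝ] E'.1 := (stdOrthonormalBasis ℝ E.1).equiv (stdOrthonormalBasis ℝ E'.1)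
    (finCongr (E.2.trans E'.2.symm))
  let L' : E.1 →ₗᵢ[ℝ] EuclideanSpace ℝ (Fin n) := E'.1.subtypeₗᵢ.comp L.toLinearIsometry
  let W : EuclideanSpace ℝ (Fin n) ≃ₗᵢ[ℝ] EuclideanSpace ℝ (Fin n) :=
    L'.extend.toLinearIsometryEquiv rfl
  refine ⟨Unitary.linearIsometryEquiv.symm W, Subtype.ext ?_⟩
  change Submodule.map ((Unitary.linearIsometryEquiv
    (Unitary.linearIsometryEquiv.symm W)).toLinearEquiv :
      EuclideanSpace ℝ (Fin n) →ₗ[ℝ] EuclideanSpace ℝ (Fin n)) E.1 = E'.1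
  rw [MulEquiv.apply_symm_apply]
  have hW : ∀ x : E.1, W x = L x := fun x => L'.extend_apply x
  ext y
  constructor
  · rintro ⟨x, hx, rfl⟩
    have : W x = L ⟨x, hx⟩ := hW ⟨x, hx⟩
    change W x ∈ E'.1
    rw [this]
    exact (L _).2
  · intro hy
    refine ⟨L.symm ⟨y, hy⟩, (L.symm _).2, ?_⟩
    change W _ = y
    rw [hW, L.apply_symm_apply]

theorem measurable_rotate {α : Type*} [MeasurableSpace α] {u : α → OrthGroup n} {f : α → Gr n k}
    (hu : Measurable u) (hf : Measurable f) : Measurable fun a => rotate (u a) (f a) := by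
  refine measurable_iff.2 ?_
  have h : (fun a => (rotate (u a) (f a)).1.starProjection) = fun a =>
      (u a : EuclideanSpace ℝ (Fin n) →L[ℝ] EuclideanSpace ℝ (Fin n)) * (f a).1.starProjection *
        ((u a)⁻¹ : OrthGroup n) := by
    funext a
    ext1 x
    exact Submodule.starProjection_map_apply (Unitary.linearIsometryEquiv (u a)) (f a).1 x
  rw [h]
  exact ((measurable_subtype_coe.comp hu).mul (measurable_iff.1 hf)).mul
    ((continuous_subtype_val.comp continuous_inv).measurable.comp hu)

/-- By transitivity E = W E₀, and right invariance of the Haar measure of O(n) absorbs W. -/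
theorem lintegral_rotate (hk : k ≤ n) {φ : Gr n k → ℝ≥0∞} (hφ : Measurable φ) (E : Gr n k) :
    ∫⁻ U, φ (rotate U E) ∂(OrthGroup.haarProb n) = ∫⁻ E, φ E ∂(haar hk) := by
  obtain ⟨W, rfl⟩ := exists_rotate_eq (coordSubspace hk) E
  rw [haar, lintegral_map hφ (continuous_rotate _).measurable]
  simp only [← rotate_mul]
  exact lintegral_mul_right_eq_self (fun U => φ (rotate U (coordSubspace hk))) W

/-- The image of the normalized Lebesgue measure on the unit ball of the space of linear maps
`ℝᵏ → ℝⁿ` under `X ↦ range X` is the Haar measure of the Grassmannian. -/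
theorem setLIntegral_ofMap (hk : k ≤ n)
    (ν : Measure (EuclideanSpace ℝ (Fin k) →L[ℝ] EuclideanSpace ℝ (Fin n))) [ν.IsAddHaarMeasure]
    {φ : Gr n k → ℝ≥0∞} (hφ : Measurable φ) :
    ∫⁻ X in Metric.closedBall 0 1, φ (ofMap hk X) ∂ν =
      ν (Metric.closedBall 0 1) * ∫⁻ E, φ E ∂(haar hk) := by
  have : ProperSpace (EuclideanSpace ℝ (Fin k) →L[ℝ] EuclideanSpace ℝ (Fin n)) :=
    FiniteDimensional.proper_real _
  have hinj := ae_injective ν (by simpa using hk)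
  have hball : MeasurableSet
      (Metric.closedBall (0 : EuclideanSpace ℝ (Fin k) →L[ℝ] EuclideanSpace ℝ (Fin n)) 1) :=
    Metric.isClosed_closedBall.measurableSet
  -- X ↦ UX preserves both Lebesgue measure and the operator norm, so φ may be averaged over O(n);
  -- the average is constant in X.
  have hU : ∀ U : OrthGroup n, ∫⁻ X in Metric.closedBall 0 1, φ (ofMap hk X) ∂ν =
      ∫⁻ X in Metric.closedBall 0 1, φ (rotate U (ofMap hk X)) ∂ν := by
    intro U
    have hd := abs_det_orthEquiv U
    have h := lintegral_comp_postcomp ν (g := orthEquiv U)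
      (abs_ne_zero.1 (by rw [hd]; exact one_ne_zero))
      ((Metric.closedBall 0 1).indicator fun X => φ (ofMap hk X))
    rw [hd, inv_one, one_pow, ENNReal.ofReal_one, one_mul, lintegral_indicator hball] at h
    rw [← h, ← lintegral_indicator hball]
    refine lintegral_congr_ae ?_
    filter_upwards [hinj] with X hX
    have hn : ‖(orthEquiv U : EuclideanSpace ℝ (Fin n) →L[ℝ] EuclideanSpace ℝ (Fin n)) ∘L X‖ =
        ‖X‖ := (Unitary.linearIsometryEquiv U).toLinearIsometry.norm_toContinuousLinearMap_comp
    simp only [Set.indicator, mem_closedBall_zero_iff, hn, rotate_eq_map,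
      ofMap_postcomp hk hX]
  calc ∫⁻ X in Metric.closedBall 0 1, φ (ofMap hk X) ∂ν
      = ∫⁻ _ : OrthGroup n, ∫⁻ X in Metric.closedBall 0 1, φ (ofMap hk X) ∂ν
          ∂(OrthGroup.haarProb n) := by simp
    _ = ∫⁻ U, ∫⁻ X in Metric.closedBall 0 1, φ (rotate U (ofMap hk X)) ∂ν
          ∂(OrthGroup.haarProb n) := lintegral_congr fun U => hU U
    _ = ∫⁻ X in Metric.closedBall 0 1, ∫⁻ U, φ (rotate U (ofMap hk X))
          ∂(OrthGroup.haarProb n) ∂ν := by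
        refine lintegral_lintegral_swap (Measurable.aemeasurable ?_)
        exact hφ.comp (measurable_rotate measurable_fst
          ((measurable_ofMap hk).comp measurable_snd))
    _ = ν (Metric.closedBall 0 1) * ∫⁻ E, φ E ∂(haar hk) := by
        simp only [lintegral_rotate hk hφ, lintegral_const, Measure.restrict_apply_univ]
        rw [mul_comm]

/-! ### Change of variables on the Grassmannian. -/

theorem ballWeight_mul_ofReal_inv_pow (m : ℕ)
    {X : EuclideanSpace ℝ (Fin k) →L[ℝ] EuclideanSpace ℝ (Fin n)}
    (hX : Function.Injective X) (c : ℝ≥0∞) :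
    ballWeight m X * (ENNReal.ofReal (X.toLinearMap.normDet⁻¹ ^ m) * c) =
      (Metric.closedBall 0 1).indicator (fun _ => c) X := by
  by_cases hB : X ∈ Metric.closedBall
    (0 : EuclideanSpace ℝ (Fin k) →L[ℝ] EuclideanSpace ℝ (Fin n)) 1
  · have h := normDet_pos_of_injective hX
    rw [ballWeight, Set.indicator_of_mem hB, Set.indicator_of_mem hB, ← mul_assoc,
      ← ENNReal.ofReal_mul (by positivity), ← mul_pow, mul_inv_cancel₀ h.ne', one_pow,
      ENNReal.ofReal_one, one_mul]
  · simp [ballWeight, hB]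

/-- **Change of variables on the Grassmannian.** -/
theorem lintegral_map_mul_volumeFactor (hk : k ≤ n)
    (h : EuclideanSpace ℝ (Fin n) ≃L[ℝ] EuclideanSpace ℝ (Fin n))
    (hdet : |(h : EuclideanSpace ℝ (Fin n) →L[ℝ] EuclideanSpace ℝ (Fin n)).det| = 1)
    {φ : Gr n k → ℝ≥0∞} (hφ : Measurable φ) :
    ∫⁻ E, ENNReal.ofReal ((volumeFactor h E)⁻¹ ^ n) * φ (map h E) ∂(haar hk) =
      ∫⁻ E, φ E ∂(haar hk) := by
  have : ProperSpace (EuclideanSpace ℝ (Fin k) →L[ℝ] EuclideanSpace ℝ (Fin n)) :=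
    FiniteDimensional.proper_real _
  let ν : Measure (EuclideanSpace ℝ (Fin k) →L[ℝ] EuclideanSpace ℝ (Fin n)) := Measure.addHaar
  have hinj := ae_injective ν (by simpa using hk)
  have hball : MeasurableSet
      (Metric.closedBall (0 : EuclideanSpace ℝ (Fin k) →L[ℝ] EuclideanSpace ℝ (Fin n)) 1) :=
    Metric.isClosed_closedBall.measurableSet
  let Φ : (EuclideanSpace ℝ (Fin k) →L[ℝ] EuclideanSpace ℝ (Fin n)) → ℝ≥0∞ := fun X =>
    ENNReal.ofReal (X.toLinearMap.normDet⁻¹ ^ n) * φ (ofMap hk X)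
  have hΦ : Measurable Φ :=
    ((continuous_normDet.measurable.inv).pow_const n).ennreal_ofReal.mul
      (hφ.comp (measurable_ofMap hk))
  have hhom : ∀ (X : EuclideanSpace ℝ (Fin k) →L[ℝ] EuclideanSpace ℝ (Fin n))
      (A : EuclideanSpace ℝ (Fin k) →L[ℝ] EuclideanSpace ℝ (Fin k)), IsUnit A →
      Φ (X ∘L A) = ENNReal.ofReal (|A.det|⁻¹ ^ finrank ℝ (EuclideanSpace ℝ (Fin n))) * Φ X := by
    intro X A hA
    simp only [Φ, ofMap_comp hk X hA, normDet_comp_endomorphism, finrank_euclideanSpace_fin]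
    rw [mul_inv, mul_comm, mul_pow, ENNReal.ofReal_mul' (by positivity)]
    ring
  -- The inverse of h is used so that the substitution X ↦ hX clears the weight and moves h into Φ.
  have key := lintegral_ballWeight_comp_mul ν (by simpa using hk) hΦ hhom
    (g := h.symm) h.symm.injective
  rw [finrank_euclideanSpace_fin] at key
  have hR : ∫⁻ X, ballWeight n X * Φ X ∂ν =
      ν (Metric.closedBall 0 1) * ∫⁻ E, φ E ∂(haar hk) := by
    rw [← setLIntegral_ofMap hk ν hφ, ← lintegral_indicator hball]
    refine lintegral_congr_ae ?_
    filter_upwards [hinj] with X hX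
    exact ballWeight_mul_ofReal_inv_pow n hX _
  have hL : ∫⁻ X, ballWeight n
      ((h.symm : EuclideanSpace ℝ (Fin n) →L[ℝ] EuclideanSpace ℝ (Fin n)) ∘L X) * Φ X ∂ν =
      ν (Metric.closedBall 0 1) *
        ∫⁻ E, ENNReal.ofReal ((volumeFactor h E)⁻¹ ^ n) * φ (map h E) ∂(haar hk) := by
    have hψ : Measurable fun E : Gr n k =>
        ENNReal.ofReal ((volumeFactor h E)⁻¹ ^ n) * φ (map h E) :=
      (((measurable_volumeFactor h).inv).pow_const n).ennreal_ofReal.mul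
        (hφ.comp (measurable_map h))
    rw [← setLIntegral_ofMap hk ν hψ, ← lintegral_indicator hball]
    have h1 := lintegral_comp_postcomp ν (g := h)
      (abs_ne_zero.1 (by rw [hdet]; exact one_ne_zero)) fun X => ballWeight n
      ((h.symm : EuclideanSpace ℝ (Fin n) →L[ℝ] EuclideanSpace ℝ (Fin n)) ∘L X) * Φ X
    rw [hdet, inv_one, one_pow, ENNReal.ofReal_one, one_mul] at h1
    rw [← h1]
    refine lintegral_congr_ae ?_
    filter_upwards [hinj] with X hX
    rw [← ContinuousLinearMap.comp_assoc, h.coe_symm_comp_coe, ContinuousLinearMap.id_comp]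
    refine Eq.trans ?_ (ballWeight_mul_ofReal_inv_pow n hX _)
    simp only [Φ, ofMap_postcomp hk hX, normDet_postcomp hk hX]
    rw [mul_inv, mul_pow, ENNReal.ofReal_mul' (pow_nonneg
      (inv_nonneg.2 (LinearMap.normDet_nonneg _)) _)]
    ring
  rw [hL, hR] at key
  exact (ENNReal.mul_right_inj (Metric.measure_closedBall_pos ν _ one_pos).ne'
    (isCompact_closedBall _ _).measure_lt_top.ne).1 key

/-- The change of variables on the Grassmannian for arbitrary, possibly nonmeasurable,
integrands. -/
theorem lintegral_map_mul_volumeFactor_of_nonmeasurable (hk : k ≤ n)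
    (h : EuclideanSpace ℝ (Fin n) ≃L[ℝ] EuclideanSpace ℝ (Fin n))
    (hdet : |(h : EuclideanSpace ℝ (Fin n) →L[ℝ] EuclideanSpace ℝ (Fin n)).det| = 1)
    (φ : Gr n k → ℝ≥0∞) :
    ∫⁻ E, ENNReal.ofReal ((volumeFactor h E)⁻¹ ^ n) * φ (map h E) ∂(haar hk) =
      ∫⁻ E, φ E ∂(haar hk) := by
  have hw : Measurable fun E : Gr n k => ENNReal.ofReal ((volumeFactor h E)⁻¹ ^ n) :=
    (((measurable_volumeFactor h).inv).pow_const n).ennreal_ofReal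
  -- The measurable case is an identity of measures. As the map is a measurable equivalence and the
  -- density is measurable and finite, it extends to all integrands.
  have hμ : ((haar hk).withDensity fun E => ENNReal.ofReal ((volumeFactor h E)⁻¹ ^ n)).map
      (mapEquiv h) = haar hk := by
    refine Measure.ext_of_lintegral _ fun φ hφ => ?_
    rw [lintegral_map hφ (mapEquiv h).measurable]
    exact (lintegral_withDensity_eq_lintegral_mul _ hw (hφ.comp (mapEquiv h).measurable)).trans
      (lintegral_map_mul_volumeFactor hk h hdet hφ)
  conv_rhs => rw [← hμ, lintegral_map_equiv, lintegral_withDensity_eq_lintegral_mul_non_measurable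
    _ hw (Filter.Eventually.of_forall fun _ => ENNReal.ofReal_lt_top)]
  rfl

/-! ### Transformation of the norms and conclusion. -/

theorem realLpNorm_map (h : EuclideanSpace ℝ (Fin n) ≃L[ℝ] EuclideanSpace ℝ (Fin n))
    (E : Gr n k) (f : EuclideanSpace ℝ (Fin n) → ℝ) (p a : ℝ) :
    realLpNorm (fun t : (map h E).1 => f t) p volume ^ a =
      ENNReal.ofReal (volumeFactor h E) ^ (a / p) *
        realLpNorm (fun t : E.1 => f (h t)) p volume ^ a := by
  have h0 : ENNReal.ofReal (volumeFactor h E) ≠ 0 := by simpa using volumeFactor_pos h E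
  rw [realLpNorm, realLpNorm, lintegral_map_eq h E fun t => ‖f t‖ₑ ^ p, ← ENNReal.rpow_mul,
    ← ENNReal.rpow_mul, one_div_mul_eq_div,
    -- The volume factor is neither 0 nor ∞, so the power splits for exponents of either sign,
    -- whatever the value of the integral.
    ENNReal.mul_rpow_eq_ite, if_neg (by simp [h0])]

end Gr

theorem mainTheorem4 {n k m : ℕ} (hk : k ≤ n) (hm : 1 ≤ m)
    (p α : Fin m → ℝ) (hp : ∀ i, p i ≠ 0) (hsum : ∑ i, α i / p i = n)
    (f : Fin m → EuclideanSpace ℝ (Fin n) → ℝ)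
    (hbdd : ∀ i, ∃ C : ℝ, ∀ x, |f i x| ≤ C)
    (hf : ∀ i, MemRealLp (f i) (p i) volume)
    (hfin : grassmannIntegral hk p α f < ∞)
    (g : EuclideanSpace ℝ (Fin n) ≃ₗ[ℝ] EuclideanSpace ℝ (Fin n))
    (hg : |LinearMap.det (g : EuclideanSpace ℝ (Fin n) →ₗ[ℝ] EuclideanSpace ℝ (Fin n))| = 1) :
    grassmannIntegral hk p α (fun i t => f i (g.symm t)) = grassmannIntegral hk p α f := by
  let h := g.symm.toContinuousLinearEquiv
  have hdet : |(h : EuclideanSpace ℝ (Fin n) →L[ℝ] EuclideanSpace ℝ (Fin n)).det| = 1 := by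
    have h1 := g.det_symm_mul_det
    have h2 := congrArg abs h1
    rw [abs_mul, hg, mul_one, abs_one] at h2
    exact h2
  rw [grassmannIntegral, grassmannIntegral]
  refine Eq.trans ?_ (Gr.lintegral_map_mul_volumeFactor_of_nonmeasurable hk h hdet _)
  refine lintegral_congr fun E => ?_
  have hv := Gr.volumeFactor_pos h E
  -- The normalization of the exponents produces exactly the power n that the Jacobian cancels.
  have h3 : ∏ i, ENNReal.ofReal (Gr.volumeFactor h E) ^ (α i / p i) =
      ENNReal.ofReal (Gr.volumeFactor h E ^ n) := by
    simp only [ENNReal.ofReal_rpow_of_pos hv]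
    rw [← ENNReal.ofReal_prod_of_nonneg fun i _ => by positivity, ← Real.rpow_sum_of_pos hv, hsum,
      Real.rpow_natCast]
  have h4 : ∏ i, realLpNorm (fun t : (Gr.map h E).1 => f i t) (p i) volume ^ α i =
      ENNReal.ofReal (Gr.volumeFactor h E ^ n) *
        ∏ i, realLpNorm (fun t : E.1 => f i (h t)) (p i) volume ^ α i := by
    rw [← h3, ← Finset.prod_mul_distrib]
    exact Finset.prod_congr rfl fun i _ => Gr.realLpNorm_map h E (f i) (p i) (α i)
  refine Eq.trans ?_ (congrArg (ENNReal.ofReal ((Gr.volumeFactor h E)⁻¹ ^ n) * ·) h4).symm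
  rw [← mul_assoc, ← ENNReal.ofReal_mul (by positivity), ← mul_pow, inv_mul_cancel₀ hv.ne',
    one_pow, ENNReal.ofReal_one, one_mul]
  rfl
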